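/- Let $n\ge 2$, let $\theta=\Theta(0)$ be a unit vector of $\mathbb{R}^n$ and let $(B_t)_{t\ge 0}$ be an $n$-dimensional Brownian motion (with an arbitrary deterministic starting point). Put $\beta_t=\theta\cdot B_t$, a one-dimensional Brownian motion, and $B'_t=B_t-\beta_t\,\theta$, an $(n-1)$-dimensional Brownian motion in the hyperplane orthogonal to $\theta$, independent of $\beta$. Let $$M^{(\infty)}_t=\sqrt{1-\tfrac1n}\left\{\theta\int_0^t\sqrt{1-e^{-ns}}\,d\beta_s+\int_0^t\sqrt{1+\frac{e^{-ns}}{n-1}}\,dB'_s\right\},\qquad Z^{(\infty)}_t=e^{-\frac{n-1}{2}t}\int_0^t e^{\frac{n-1}{2}s}\,dM^{(\infty)}_s ,$$ $$Z^{(\infty)}_\infty=\sqrt{1-\tfrac1n}\int_0^\infty e^{-\frac{n-1}{2}u}\,dB_u ,$$ where all the integrals are stochastic integrals of deterministic functions, that is, limits in $L^2$ of the integrals of step functions. Then all the stochastic integrals above and below exist, and: (a) as $t\to\infty$, the random vector $Z^{(\infty)}_t$ converges in law to $Z^{(\infty)}_\infty$; (b) as $t\to\infty$, the difference $$Z^{(\infty)}_t-e^{-\frac{n-1}{2}t}\int_0^t\sqrt{1-\tfrac1n}\;e^{\frac{n-1}{2}s}\,dB_s$$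 tends to $0$ in $L^2$. -/

import Mathlib

open MeasureTheory ProbabilityTheory Filter Topology
open scoped NNReal ENNReal RealInnerProductSpace

noncomputable section

/-- An `n`-dimensional Brownian motion starting from the point `a`: the coordinates of `B - a` are
real Brownian motions (starting from `0`, almost surely continuous), and the coordinate processes
are mutually independent. -/
structure IsBrownianMotionFrom {Ω : Type*} [MeasurableSpace Ω] {n : ℕ}
    (a : EuclideanSpace ℝ (Fin n)) (B : ℝ≥0 → Ω → EuclideanSpace ℝ (Fin n))
    (P : Measure Ω) : Prop where
  isBrownianReal : ∀ i, IsBrownianReal (fun t ω ↦ B t ω i - a i) P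
  iIndepFun : iIndepFun (fun (i : Fin n) (ω : Ω) (t : ℝ≥0) ↦ B t ω i) P

/-- (A presentation of) a deterministic step function `∑ᵢ cᵢ 1_{(aᵢ, bᵢ]}` on the time axis. -/
structure StepFunction where
  /-- number of intervals -/
  size : ℕ
  /-- coefficients -/
  coeff : Fin size → ℝ
  /-- left end points -/
  left : Fin size → ℝ≥0
  /-- right end points -/
  right : Fin size → ℝ≥0
  left_le_right : ∀ i, left i ≤ right i

/-- The function `∑ᵢ cᵢ 1_{(aᵢ, bᵢ]}`. -/
def StepFunction.toFun (φ : StepFunction) (s : ℝ) : ℝ :=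
  ∑ i, (Set.Ioc (φ.left i : ℝ) (φ.right i : ℝ)).indicator (fun _ ↦ φ.coeff i) s

/-- The elementary stochastic integral `∫ φ dX = ∑ᵢ cᵢ (X_{bᵢ} - X_{aᵢ})`. -/
def StepFunction.integral {Ω E : Type*} [NormedAddCommGroup E] [NormedSpace ℝ E]
    (φ : StepFunction) (X : ℝ≥0 → Ω → E) (ω : Ω) : E :=
  ∑ i, φ.coeff i • (X (φ.right i) ω - X (φ.left i) ω)

/-- `Y` is (a version of) the Wiener integral `∫₀^∞ f(s) dX_s` of the deterministic function
`f ∈ L²(0, ∞)` against the process `X`: the elementary integrals `∫ φ dX` converge to `Y` in `L²(P)`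
as the step function `φ` converges to `f` in `L²(0, ∞)`. Step functions being dense in `L²(0, ∞)`,
such a `Y` is unique up to almost sure equality. -/
structure IsWienerIntegral {Ω E : Type*} [MeasurableSpace Ω] [NormedAddCommGroup E]
    [NormedSpace ℝ E] (P : Measure Ω) (X : ℝ≥0 → Ω → E) (f : ℝ → ℝ) (Y : Ω → E) : Prop where
  memLp_integrand : MemLp f 2 (volume.restrict (Set.Ioi 0))
  memLp : MemLp Y 2 P
  tendsto : Tendsto (fun φ : StepFunction ↦ eLpNorm (fun ω ↦ φ.integral X ω - Y ω) 2 P)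
    (comap (fun φ : StepFunction ↦
      eLpNorm (fun s ↦ φ.toFun s - f s) 2 (volume.restrict (Set.Ioi 0))) (𝓝 0)) (𝓝 0)

/-- The Wiener integral `∫₀^∞ f(s) dX_s` exists. -/
def HasWienerIntegral {Ω E : Type*} [MeasurableSpace Ω] [NormedAddCommGroup E]
    [NormedSpace ℝ E] (P : Measure Ω) (X : ℝ≥0 → Ω → E) (f : ℝ → ℝ) : Prop :=
  ∃ Y : Ω → E, IsWienerIntegral P X f Y

open scoped Classical in
/-- The Wiener integral `∫₀^∞ f(s) dX_s` (a version of it; `0` if it does not exist). -/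
def wienerIntegral {Ω E : Type*} [MeasurableSpace Ω] [NormedAddCommGroup E]
    [NormedSpace ℝ E] (P : Measure Ω) (X : ℝ≥0 → Ω → E) (f : ℝ → ℝ) : Ω → E :=
  if h : HasWienerIntegral P X f then h.choose else 0

/-- The restriction `f 1_{(0, t]}`, so that `∫₀^t f dX = ∫₀^∞ (upTo t f) dX`. -/
def upTo (t : ℝ≥0) (f : ℝ → ℝ) : ℝ → ℝ := (Set.Ioc 0 (t : ℝ)).indicator f

/-- The component `β_t = θ ⋅ B_t` of `B` in the direction of `θ`. -/
def radialPart {Ω : Type*} {n : ℕ} (θ : EuclideanSpace ℝ (Fin n))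
    (B : ℝ≥0 → Ω → EuclideanSpace ℝ (Fin n)) (t : ℝ≥0) (ω : Ω) : ℝ :=
  ⟪θ, B t ω⟫

/-- The component `B'_t = B_t - β_t θ` of `B` in the hyperplane orthogonal to the unit
vector `θ`. -/
def tangentialPart {Ω : Type*} {n : ℕ} (θ : EuclideanSpace ℝ (Fin n))
    (B : ℝ≥0 → Ω → EuclideanSpace ℝ (Fin n)) (t : ℝ≥0) (ω : Ω) : EuclideanSpace ℝ (Fin n) :=
  B t ω - radialPart θ B t ω • θ

/-- The integrand `√(1 - e^{-ns})`. -/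
def radialCoeff (n : ℕ) (s : ℝ) : ℝ := √(1 - Real.exp (-(n * s)))

/-- The integrand `√(1 + e^{-ns} / (n-1))`. -/
def tangentialCoeff (n : ℕ) (s : ℝ) : ℝ := √(1 + Real.exp (-(n * s)) / (n - 1))

/-- The integrand `e^{(n-1)s/2}`. -/
def growth (n : ℕ) (s : ℝ) : ℝ := Real.exp ((n - 1) / 2 * s)

/-- The integrand `e^{-(n-1)s/2}`. -/
def decay (n : ℕ) (s : ℝ) : ℝ := Real.exp (-((n - 1) / 2 * s))

/-- The Gaussian martingale
`M_t = √(1 - 1/n) (θ ∫₀^t √(1 - e^{-ns}) dβ_s + ∫₀^t √(1 + e^{-ns}/(n-1)) dB'_s)`. -/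
def limitMartingale {Ω : Type*} [MeasurableSpace Ω] (P : Measure Ω) {n : ℕ}
    (θ : EuclideanSpace ℝ (Fin n)) (B : ℝ≥0 → Ω → EuclideanSpace ℝ (Fin n))
    (t : ℝ≥0) (ω : Ω) : EuclideanSpace ℝ (Fin n) :=
  √(1 - 1 / (n : ℝ)) •
    (wienerIntegral P (radialPart θ B) (upTo t (radialCoeff n)) ω • θ +
      wienerIntegral P (tangentialPart θ B) (upTo t (tangentialCoeff n)) ω)

/-- The limit process `Z_t = e^{-(n-1)t/2} ∫₀^t e^{(n-1)s/2} dM_s`. -/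
def limitProcess {Ω : Type*} [MeasurableSpace Ω] (P : Measure Ω) {n : ℕ}
    (θ : EuclideanSpace ℝ (Fin n)) (B : ℝ≥0 → Ω → EuclideanSpace ℝ (Fin n))
    (t : ℝ≥0) (ω : Ω) : EuclideanSpace ℝ (Fin n) :=
  decay n t • wienerIntegral P (limitMartingale P θ B) (upTo t (growth n)) ω

/-- The random vector `Z_∞ = √(1 - 1/n) ∫₀^∞ e^{-(n-1)u/2} dB_u`. -/
def limitVector {Ω : Type*} [MeasurableSpace Ω] (P : Measure Ω) {n : ℕ}
    (B : ℝ≥0 → Ω → EuclideanSpace ℝ (Fin n)) (ω : Ω) : EuclideanSpace ℝ (Fin n) :=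
  √(1 - 1 / (n : ℝ)) • wienerIntegral P B (decay n) ω

/-- The process `e^{-(n-1)t/2} ∫₀^t √(1 - 1/n) e^{(n-1)s/2} dB_s`. -/
def comparisonProcess {Ω : Type*} [MeasurableSpace Ω] (P : Measure Ω) {n : ℕ}
    (B : ℝ≥0 → Ω → EuclideanSpace ℝ (Fin n)) (t : ℝ≥0) (ω : Ω) : EuclideanSpace ℝ (Fin n) :=
  decay n t • wienerIntegral P B (upTo t (fun s ↦ √(1 - 1 / (n : ℝ)) * growth n s)) ω

end

/-!
A process `X` whose increments `X_t - X_0` have the Gram matrix `c min(s, t)` in `L²(P)` is, up to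
the factor `√c`, an isometric copy of the indicators `1_{(0, t]}` in `L²(0, ∞)`. These indicators
span a dense subspace (`denseRange_stepMap`), so that integration against `X` extends to a bounded
operator `T : L²(0, ∞) → L²(P)`, and the Wiener integral of `f` exists and equals `T f` almost
surely (`IsIntegrator.hasWienerIntegral`, `IsIntegrator.wienerIntegral_ae_eq`). Brownian motion
has such an operator `T`; operators for `β`, `B'` and `M` are obtained from it by composing with
linear maps of `ℝⁿ` and with multiplication by the bounded coefficients of `M`
(`isIntegrator_limitMartingale`).

For (b), the integrals against `M` and against `√(1 - 1/n) B` differ through the distances of the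
two coefficients of `M` to `1`, which are at most `e^{-ns}`. Multiplied by the integrand
`e^{(n-1)s/2}` they are at most `e^{-(n-1)s/2}`, which is square integrable on `(0, ∞)`. The
difference of the integrals is thus bounded in `L²(P)`, and the factor `e^{-(n-1)t/2}` makes it
tend to `0`.

For (a), it remains to find the limit law of `e^{-(n-1)t/2} ∫₀^t √(1 - 1/n) e^{(n-1)s/2} dB_s`.
The law of `T f` is centered Gaussian with covariance `‖f‖² I` (`charFun_map_integrator`), so it
depends continuously on the norm of `f` only (`tendstoInDistribution_integrator`). By time
reversal the norm of `e^{-(n-1)(t-s)/2} 1_{(0, t]}(s)` is that of `e^{-(n-1)u/2} 1_{(0, t]}(u)`,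
which converges to the norm of `e^{-(n-1)u/2}`, the integrand of `Z_∞`.
-/

open MeasureTheory ProbabilityTheory Filter Topology
open scoped NNReal ENNReal RealInnerProductSpace

noncomputable section

/-! ### Step functions in `L²(0, ∞)` -/

/-- Lebesgue measure on the open half-line `(0, ∞)`, the time axis of the integrands. -/
abbrev timeMeasure : Measure ℝ := volume.restrict (Set.Ioi 0)

lemma timeMeasure_Ioc_ne_top (a b : ℝ) : timeMeasure (Set.Ioc a b) ≠ ∞ :=
  ((Measure.restrict_apply_le _ _).trans_lt measure_Ioc_lt_top).ne

/-- The indicator `1_{(0, t]}` as an element of `L²(0, ∞)`. -/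
def timeIndicator (t : ℝ≥0) : Lp ℝ 2 timeMeasure :=
  indicatorConstLp 2 measurableSet_Ioc (timeMeasure_Ioc_ne_top 0 t) 1

lemma coeFn_timeIndicator (t : ℝ≥0) :
    timeIndicator t =ᵐ[timeMeasure] (Set.Ioc 0 (t : ℝ)).indicator fun _ ↦ 1 :=
  indicatorConstLp_coeFn

lemma timeIndicator_zero : timeIndicator 0 = 0 := by
  rw [Lp.eq_zero_iff_ae_eq_zero]
  filter_upwards [coeFn_timeIndicator 0] with s hs
  simp [hs]

lemma inner_timeIndicator (s t : ℝ≥0) :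
    ⟪timeIndicator s, timeIndicator t⟫ = min (s : ℝ) t := by
  have h : Set.Ioc (0 : ℝ) s ∩ Set.Ioc 0 t = Set.Ioc 0 (min (s : ℝ) t) := by
    rw [Set.Ioc_inter_Ioc]; simp
  rw [timeIndicator, timeIndicator, L2.inner_indicatorConstLp_indicatorConstLp _ _
      (timeMeasure_Ioc_ne_top 0 s) (timeMeasure_Ioc_ne_top 0 t), h,
    measureReal_restrict_apply measurableSet_Ioc, Set.inter_eq_left.2 Set.Ioc_subset_Ioi_self]
  simp

/-- The linear map that sends finitely many weights `xₜ` to the step function `∑ₜ xₜ 1_{(0, t]}`,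
as an element of `L²(0, ∞)`. -/
def stepMap : (ℝ≥0 →₀ ℝ) →ₗ[ℝ] Lp ℝ 2 timeMeasure := Finsupp.linearCombination ℝ timeIndicator

/-- A function in `L²(0, ∞)` that is orthogonal to all the `1_{(0, t]}` has a vanishing primitive,
hence vanishes almost everywhere by Lebesgue's differentiation theorem. -/
lemma eq_zero_of_forall_inner_timeIndicator (f : Lp ℝ 2 timeMeasure)
    (h : ∀ t, ⟪timeIndicator t, f⟫ = 0) : f = 0 := by
  have hint (t : ℝ≥0) : ∫ x in Set.Ioc 0 (t : ℝ), f x = 0 := by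
    have := h t
    rw [timeIndicator, L2.inner_indicatorConstLp_one] at this
    rwa [Measure.restrict_restrict measurableSet_Ioc,
      Set.inter_eq_left.2 Set.Ioc_subset_Ioi_self] at this
  set g : ℝ → ℝ := (Set.Ioi 0).indicator f with hg
  have hgLp : MemLp g 2 := (memLp_indicator_iff_restrict measurableSet_Ioi).2 (Lp.memLp f)
  have hgloc : LocallyIntegrable g := hgLp.locallyIntegrable (by norm_num)
  have hprim (x : ℝ) : ∫ y in (0 : ℝ)..x, g y = 0 := by
    rcases le_total 0 x with hx | hx
    · lift x to ℝ≥0 using hx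
      rw [intervalIntegral.integral_of_le x.coe_nonneg]
      refine Eq.trans ?_ (hint x)
      refine setIntegral_congr_fun measurableSet_Ioc fun y hy ↦ ?_
      have hy' : y ∈ Set.Ioi (0 : ℝ) := (Set.mem_Ioc.1 hy).1
      exact Set.indicator_of_mem hy' _
    · rw [intervalIntegral.integral_of_ge hx, neg_eq_zero]
      refine setIntegral_eq_zero_of_forall_eq_zero fun y hy ↦ ?_
      have hy' : y ∉ Set.Ioi (0 : ℝ) := fun h ↦ (Set.mem_Ioc.1 hy).2.not_gt h
      exact Set.indicator_of_notMem hy' _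
  have hg0 : ∀ᵐ x, g x = 0 := by
    filter_upwards [LocallyIntegrable.ae_hasDerivAt_integral hgloc] with x hx
    have := hx 0
    simp only [hprim] at this
    exact this.unique (hasDerivAt_const x 0)
  rw [Lp.eq_zero_iff_ae_eq_zero]
  filter_upwards [ae_restrict_of_ae hg0, ae_restrict_mem measurableSet_Ioi] with x hx hx0
  rwa [hg, Set.indicator_of_mem hx0] at hx

lemma denseRange_stepMap : DenseRange stepMap := by
  have h : (LinearMap.range stepMap).topologicalClosure = ⊤ := by
    rw [Submodule.topologicalClosure_eq_top_iff, Submodule.eq_bot_iff]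
    intro f hf
    refine eq_zero_of_forall_inner_timeIndicator f fun t ↦ ?_
    exact (Submodule.mem_orthogonal _ _).1 hf _ ⟨Finsupp.single t 1, by simp [stepMap]⟩
  have h' : Dense ((LinearMap.range stepMap : Submodule ℝ _) : Set (Lp ℝ 2 timeMeasure)) :=
    (Submodule.dense_iff_topologicalClosure_eq_top).2 h
  rwa [LinearMap.coe_range] at h'

namespace StepFunction

/-- The class in `L²(0, ∞)` of a step function. -/
def toLp (φ : StepFunction) : Lp ℝ 2 timeMeasure :=
  ∑ i, φ.coeff i • (timeIndicator (φ.right i) - timeIndicator (φ.left i))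

lemma coeFn_toLp (φ : StepFunction) : φ.toLp =ᵐ[timeMeasure] φ.toFun := by
  have h : ∀ᵐ s ∂timeMeasure, ∀ i,
      (φ.coeff i • (timeIndicator (φ.right i) - timeIndicator (φ.left i)) : Lp ℝ 2 timeMeasure) s =
        (Set.Ioc (φ.left i : ℝ) (φ.right i : ℝ)).indicator (fun _ ↦ φ.coeff i) s := by
    rw [ae_all_iff]
    intro i
    filter_upwards [
      Lp.coeFn_smul (φ.coeff i) (timeIndicator (φ.right i) - timeIndicator (φ.left i)),
      Lp.coeFn_sub (timeIndicator (φ.right i)) (timeIndicator (φ.left i)),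
      coeFn_timeIndicator (φ.right i), coeFn_timeIndicator (φ.left i),
      ae_restrict_mem measurableSet_Ioi] with s h1 h2 h3 h4 h5
    have hlr : (φ.left i : ℝ) ≤ φ.right i := φ.left_le_right i
    have h5' : 0 < s := h5
    rw [h1, Pi.smul_apply, h2, Pi.sub_apply, h3, h4]
    simp only [Set.indicator_apply, Set.mem_Ioc, h5', true_and, smul_eq_mul]
    grind
  filter_upwards [Lp.coeFn_finsetSum Finset.univ
    (fun i ↦ φ.coeff i • (timeIndicator (φ.right i) - timeIndicator (φ.left i))), h] with s h1 h2
  rw [toLp, h1, Finset.sum_apply, toFun]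
  exact Finset.sum_congr rfl fun i _ ↦ h2 i

/-- The step function `∑ₜ xₜ 1_{(0, t]}`. -/
def ofFinsupp (x : ℝ≥0 →₀ ℝ) : StepFunction where
  size := x.support.card
  coeff i := x (x.support.equivFin.symm i)
  left _ := 0
  right i := x.support.equivFin.symm i
  left_le_right _ := zero_le

lemma toLp_ofFinsupp (x : ℝ≥0 →₀ ℝ) : (ofFinsupp x).toLp = stepMap x := by
  have h : (ofFinsupp x).toLp = ∑ i : Fin x.support.card, x (x.support.equivFin.symm i) •
      timeIndicator (x.support.equivFin.symm i) :=
    Finset.sum_congr rfl fun i _ ↦ by simp [ofFinsupp, timeIndicator_zero]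
  rw [h, Equiv.sum_comp x.support.equivFin.symm
    (fun t : x.support ↦ x (t : ℝ≥0) • timeIndicator (t : ℝ≥0))]
  exact Finset.sum_coe_sort x.support fun t ↦ x t • timeIndicator t

lemma eLpNorm_toFun_sub {f : ℝ → ℝ} (hf : MemLp f 2 timeMeasure) (φ : StepFunction) :
    eLpNorm (fun s ↦ φ.toFun s - f s) 2 timeMeasure = ‖φ.toLp - hf.toLp f‖ₑ := by
  rw [Lp.enorm_def]
  refine eLpNorm_congr_ae ?_
  filter_upwards [Lp.coeFn_sub φ.toLp (hf.toLp f), φ.coeFn_toLp, hf.coeFn_toLp] with s h1 h2 h3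
  rw [h1, Pi.sub_apply, h2, h3]

/-- Step functions are dense in `L²(0, ∞)`. -/
lemma comap_neBot {f : ℝ → ℝ} (hf : MemLp f 2 timeMeasure) :
    (comap (fun φ : StepFunction ↦ eLpNorm (fun s ↦ φ.toFun s - f s) 2 timeMeasure)
      (𝓝 0)).NeBot := by
  rw [comap_neBot_iff]
  intro u hu
  obtain ⟨ε, hε, hεu⟩ := ENNReal.nhds_zero_basis.mem_iff.1 hu
  obtain ⟨_, ⟨x, rfl⟩, hx⟩ := EMetric.mem_closure_iff.1 (denseRange_stepMap (hf.toLp f)) ε hε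
  refine ⟨ofFinsupp x, hεu ?_⟩
  rw [eLpNorm_toFun_sub hf, toLp_ofFinsupp]
  rw [edist_comm, edist_eq_enorm_sub] at hx
  simpa using hx

end StepFunction

/-! ### Wiener integrals as bounded operators -/

section

variable {Ω : Type*} [MeasurableSpace Ω] {P : Measure Ω}

/-- The bounded operator `T : L²(0, ∞) → L²(P; E)` represents integration against the process `X`:
it sends `1_{(0, t]}` to the increment `X_t - X_0`. -/
def IsIntegrator {E : Type*} [NormedAddCommGroup E] [NormedSpace ℝ E] (P : Measure Ω)
    (X : ℝ≥0 → Ω → E) (T : Lp ℝ 2 timeMeasure →L[ℝ] Lp E 2 P) : Prop :=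
  ∀ t, (fun ω ↦ X t ω - X 0 ω) =ᵐ[P] T (timeIndicator t)

namespace IsIntegrator

variable {E : Type*} [NormedAddCommGroup E] [NormedSpace ℝ E] {X : ℝ≥0 → Ω → E}
  {T : Lp ℝ 2 timeMeasure →L[ℝ] Lp E 2 P} {f : ℝ → ℝ}

lemma integral_step (hT : IsIntegrator P X T) (φ : StepFunction) :
    φ.integral X =ᵐ[P] T φ.toLp := by
  have h : ∀ᵐ ω ∂P, ∀ i, (φ.coeff i • (T (timeIndicator (φ.right i)) -
      T (timeIndicator (φ.left i))) : Lp E 2 P) ω =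
        φ.coeff i • (X (φ.right i) ω - X (φ.left i) ω) := by
    rw [ae_all_iff]
    intro i
    filter_upwards [Lp.coeFn_smul (φ.coeff i) (T (timeIndicator (φ.right i)) -
      T (timeIndicator (φ.left i))), Lp.coeFn_sub (T (timeIndicator (φ.right i)))
      (T (timeIndicator (φ.left i))), hT (φ.right i), hT (φ.left i)] with ω h1 h2 h3 h4
    rw [h1, Pi.smul_apply, h2, Pi.sub_apply, ← h3, ← h4, sub_sub_sub_cancel_right]
  filter_upwards [Lp.coeFn_finsetSum Finset.univ (fun i ↦ φ.coeff i •
    (T (timeIndicator (φ.right i)) - T (timeIndicator (φ.left i)))), h] with ω h1 h2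
  simp only [StepFunction.toLp, map_sum, map_smul, map_sub]
  rw [h1, Finset.sum_apply, StepFunction.integral]
  exact Finset.sum_congr rfl fun i _ ↦ (h2 i).symm

lemma isWienerIntegral (hT : IsIntegrator P X T) (hf : MemLp f 2 timeMeasure) :
    IsWienerIntegral P X f (T (hf.toLp f)) where
  memLp_integrand := hf
  memLp := Lp.memLp _
  tendsto := by
    have hle (φ : StepFunction) : eLpNorm (fun ω ↦ φ.integral X ω - T (hf.toLp f) ω) 2 P ≤
        ‖T‖ₑ * eLpNorm (fun s ↦ φ.toFun s - f s) 2 timeMeasure := by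
      have : eLpNorm (fun ω ↦ φ.integral X ω - T (hf.toLp f) ω) 2 P =
          ‖T (φ.toLp - hf.toLp f)‖ₑ := by
        rw [Lp.enorm_def, map_sub]
        refine eLpNorm_congr_ae ?_
        filter_upwards [hT.integral_step φ, Lp.coeFn_sub (T φ.toLp) (T (hf.toLp f))]
          with ω h1 h2
        rw [h2, Pi.sub_apply, h1]
      rw [this, StepFunction.eLpNorm_toFun_sub hf]
      exact T.le_opENorm _
    refine tendsto_of_tendsto_of_tendsto_of_le_of_le tendsto_const_nhds ?_
      (fun _ ↦ zero_le) hle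
    have h := ENNReal.Tendsto.const_mul (a := ‖T‖ₑ) (tendsto_comap (f := fun φ : StepFunction ↦
      eLpNorm (fun s ↦ φ.toFun s - f s) 2 timeMeasure) (x := 𝓝 0)) (Or.inr enorm_ne_top)
    rwa [mul_zero] at h

lemma hasWienerIntegral (hT : IsIntegrator P X T) (hf : MemLp f 2 timeMeasure) :
    HasWienerIntegral P X f :=
  ⟨_, hT.isWienerIntegral hf⟩

end IsIntegrator

/-- A Wiener integral is unique up to almost sure equality: the step functions that converge to `f`
form a nontrivial filter, along which the elementary integrals have only one limit. -/
lemma IsWienerIntegral.ae_eq {E : Type*} [NormedAddCommGroup E] [NormedSpace ℝ E]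
    {X : ℝ≥0 → Ω → E} {f : ℝ → ℝ} {Y Z : Ω → E} (hX : ∀ φ : StepFunction,
      AEStronglyMeasurable (φ.integral X) P) (hY : IsWienerIntegral P X f Y)
    (hZ : IsWienerIntegral P X f Z) : Y =ᵐ[P] Z := by
  have := StepFunction.comap_neBot hY.memLp_integrand
  have hle (φ : StepFunction) : eLpNorm (Y - Z) 2 P ≤
      eLpNorm (fun ω ↦ φ.integral X ω - Y ω) 2 P +
        eLpNorm (fun ω ↦ φ.integral X ω - Z ω) 2 P := by
    have h1 : Y - Z = (fun ω ↦ φ.integral X ω - Z ω) - fun ω ↦ φ.integral X ω - Y ω := by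
      ext ω; simp
    rw [h1, add_comm]
    exact eLpNorm_sub_le ((hX φ).sub hZ.memLp.1) ((hX φ).sub hY.memLp.1) (by norm_num)
  have h0 : eLpNorm (Y - Z) 2 P ≤ 0 + 0 :=
    ge_of_tendsto' (hY.tendsto.add hZ.tendsto) hle
  rw [add_zero, nonpos_iff_eq_zero, eLpNorm_eq_zero_iff (hY.memLp.1.sub hZ.memLp.1) (by simp)] at h0
  filter_upwards [h0] with ω hω
  exact sub_eq_zero.1 hω

lemma IsIntegrator.wienerIntegral_ae_eq {E : Type*} [NormedAddCommGroup E] [NormedSpace ℝ E]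
    {X : ℝ≥0 → Ω → E} {T : Lp ℝ 2 timeMeasure →L[ℝ] Lp E 2 P} {f : ℝ → ℝ}
    (hT : IsIntegrator P X T) (hf : MemLp f 2 timeMeasure) :
    wienerIntegral P X f =ᵐ[P] T (hf.toLp f) := by
  have h := hT.hasWienerIntegral hf
  rw [wienerIntegral, dif_pos h]
  exact IsWienerIntegral.ae_eq
    (fun φ ↦ (Lp.aestronglyMeasurable _).congr (hT.integral_step φ).symm) h.choose_spec
    (hT.isWienerIntegral hf)

/-- Two families whose Gram matrices are proportional have linear combinations with proportional
norms. -/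
lemma norm_sq_linearCombination_of_inner {ι V W : Type*} [NormedAddCommGroup V]
    [InnerProductSpace ℝ V] [NormedAddCommGroup W] [InnerProductSpace ℝ W] {v : ι → V} {w : ι → W}
    {c : ℝ} (h : ∀ s t, ⟪v s, v t⟫ = c * ⟪w s, w t⟫) (x : ι →₀ ℝ) :
    ‖Finsupp.linearCombination ℝ v x‖ ^ 2 = c * ‖Finsupp.linearCombination ℝ w x‖ ^ 2 := by
  simp only [← real_inner_self_eq_norm_sq, Finsupp.linearCombination_apply, Finsupp.sum,
    sum_inner, inner_sum, real_inner_smul_left, real_inner_smul_right, h, Finset.mul_sum]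
  exact Finset.sum_congr rfl fun _ _ ↦ Finset.sum_congr rfl fun _ _ ↦ by ring

/-- A process with orthogonal increments of variance proportional to time has an integrator,
which multiplies the norm by a constant. -/
lemma exists_isIntegrator {E : Type*} [NormedAddCommGroup E] [InnerProductSpace ℝ E]
    [CompleteSpace E] {X : ℝ≥0 → Ω → E} (hX : ∀ t, MemLp (fun ω ↦ X t ω - X 0 ω) 2 P) {c : ℝ}
    (hcov : ∀ s t, ∫ ω, ⟪X s ω - X 0 ω, X t ω - X 0 ω⟫ ∂P = c * min (s : ℝ) t) :
    ∃ T, IsIntegrator P X T := by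
  set u : ℝ≥0 → Lp E 2 P := fun t ↦ (hX t).toLp _ with hu
  have hgram (s t : ℝ≥0) : ⟪u s, u t⟫ = c * ⟪timeIndicator s, timeIndicator t⟫ := by
    rw [inner_timeIndicator, ← hcov, L2.inner_def]
    refine integral_congr_ae ?_
    filter_upwards [(hX s).coeFn_toLp, (hX t).coeFn_toLp] with ω h1 h2
    rw [hu, h1, h2]
  have hbound : ∀ x, ‖Finsupp.linearCombination ℝ u x‖ ≤ √c * ‖stepMap x‖ := by
    intro x
    have h := norm_sq_linearCombination_of_inner hgram x
    rw [← Real.sqrt_sq (norm_nonneg (Finsupp.linearCombination ℝ u x)), h,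
      Real.sqrt_mul' _ (sq_nonneg _), Real.sqrt_sq (norm_nonneg _)]
    rfl
  refine ⟨(Finsupp.linearCombination ℝ u).extendOfNorm stepMap, fun t ↦ ?_⟩
  have h := LinearMap.extendOfNorm_eq denseRange_stepMap ⟨√c, hbound⟩ (Finsupp.single t 1)
  have h1 : stepMap (Finsupp.single t 1) = timeIndicator t := by simp [stepMap]
  rw [h1, Finsupp.linearCombination_single, one_smul] at h
  rw [h]
  exact (hX t).coeFn_toLp.symm

/-! ### Gaussian laws of the integrals against Brownian motion -/

namespace IsBrownianMotionFrom

variable {n : ℕ} {a : EuclideanSpace ℝ (Fin n)} {B : ℝ≥0 → Ω → EuclideanSpace ℝ (Fin n)}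

lemma isPreBrownianReal_sub (hB : IsBrownianMotionFrom a B P) (i : Fin n) :
    IsPreBrownianReal (fun t ω ↦ B t ω i - B 0 ω i) P := by
  refine (hB.isBrownianReal i).toIsPreBrownianReal.congr fun t ↦ ?_
  filter_upwards [(hB.isBrownianReal i).eval_zero_ae_eq_zero] with ω hω
  linarith

lemma memLp_sub_apply (hB : IsBrownianMotionFrom a B P) (i : Fin n) (t : ℝ≥0) :
    MemLp (fun ω ↦ B t ω i - B 0 ω i) 2 P := by
  have hG := IsPreBrownianReal.isGaussianProcess (hB.isPreBrownianReal_sub i)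
  exact (hG.hasGaussianLaw_eval t).memLp_two

lemma memLp_sub (hB : IsBrownianMotionFrom a B P) (t : ℝ≥0) :
    MemLp (fun ω ↦ B t ω - B 0 ω) 2 P :=
  MemLp.of_eval_piLp fun i ↦ hB.memLp_sub_apply i t

variable [IsProbabilityMeasure P]

lemma integral_sub_mul_sub (hB : IsBrownianMotionFrom a B P) (i : Fin n) (s t : ℝ≥0) :
    ∫ ω, (B s ω i - B 0 ω i) * (B t ω i - B 0 ω i) ∂P = min (s : ℝ) t := by
  have h := (hB.isPreBrownianReal_sub i).covariance_eval s t
  rw [covariance_eq_sub (hB.memLp_sub_apply i s) (hB.memLp_sub_apply i t),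
    (hB.isPreBrownianReal_sub i).integral_eval s, zero_mul, sub_zero] at h
  simpa using h

lemma integral_inner_sub_sub (hB : IsBrownianMotionFrom a B P) (s t : ℝ≥0) :
    ∫ ω, ⟪B s ω - B 0 ω, B t ω - B 0 ω⟫ ∂P = n * min (s : ℝ) t := by
  simp only [PiLp.inner_apply, PiLp.sub_apply, RCLike.inner_apply, conj_trivial]
  rw [integral_finsetSum]
  · simp only [mul_comm, integral_sub_mul_sub hB]
    simp [mul_comm]
  · exact fun i _ ↦ (hB.memLp_sub_apply i t).integrable_mul (hB.memLp_sub_apply i s)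

lemma exists_isIntegrator (hB : IsBrownianMotionFrom a B P) : ∃ T, IsIntegrator P B T :=
  _root_.exists_isIntegrator hB.memLp_sub hB.integral_inner_sub_sub

/-- The integral of the step function `∑ₜ xₜ 1_{(0, t]}` against one coordinate of the Brownian
motion is a centered Gaussian variable, whose variance is given by Itô's isometry. -/
lemma hasLaw_sum_mul_sub (hB : IsBrownianMotionFrom a B P) (i : Fin n) (x : ℝ≥0 →₀ ℝ) :
    HasLaw (fun ω ↦ ∑ t ∈ x.support, x t * (B t ω i - B 0 ω i))
      (gaussianReal 0 (‖stepMap x‖₊ ^ 2)) P := by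
  have hG : HasGaussianLaw (fun ω ↦ ∑ t ∈ x.support, x t * (B t ω i - B 0 ω i)) P := by
    have h := IsPreBrownianReal.isGaussianProcess (hB.isPreBrownianReal_sub i)
    exact (h.smul x).hasGaussianLaw_fun_sum (I := x.support)
  have hmean : ∫ ω, ∑ t ∈ x.support, x t * (B t ω i - B 0 ω i) ∂P = 0 := by
    rw [integral_finsetSum _ fun t _ ↦
      ((hB.isPreBrownianReal_sub i).integrable_eval t).const_mul (x t)]
    refine Finset.sum_eq_zero fun t _ ↦ ?_
    rw [integral_const_mul, (hB.isPreBrownianReal_sub i).integral_eval t, mul_zero]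
  have hvar : Var[fun ω ↦ ∑ t ∈ x.support, x t * (B t ω i - B 0 ω i); P] = ‖stepMap x‖ ^ 2 := by
    rw [← covariance_self hG.aemeasurable, covariance_fun_sum_fun_sum'
      (fun t _ ↦ (hB.memLp_sub_apply i t).const_mul _)
      (fun t _ ↦ (hB.memLp_sub_apply i t).const_mul _)]
    simp only [covariance_const_mul_left, covariance_const_mul_right,
      (hB.isPreBrownianReal_sub i).covariance_fun_eval]
    simp only [← real_inner_self_eq_norm_sq, stepMap, Finsupp.linearCombination_apply,
      Finsupp.sum, sum_inner, inner_sum, real_inner_smul_left, real_inner_smul_right,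
      inner_timeIndicator, NNReal.coe_min]
    exact Finset.sum_congr rfl fun s _ ↦ Finset.sum_congr rfl fun t _ ↦ by
      rw [mul_left_comm, min_comm]
  refine ⟨hG.aemeasurable, ?_⟩
  rw [hG.map_eq_gaussianReal, hmean, hvar]
  congr
  ext
  simp

lemma charFun_map_integrator_step (hB : IsBrownianMotionFrom a B P)
    {T : Lp ℝ 2 timeMeasure →L[ℝ] Lp (EuclideanSpace ℝ (Fin n)) 2 P} (hT : IsIntegrator P B T)
    (x : ℝ≥0 →₀ ℝ) (v : EuclideanSpace ℝ (Fin n)) :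
    charFun (P.map (T (stepMap x))) v =
      Complex.exp (-((‖v‖ ^ 2 * ‖stepMap x‖ ^ 2 / 2 : ℝ) : ℂ)) := by
  set Y : Fin n → Ω → ℝ := fun i ω ↦ ∑ t ∈ x.support, x t * (B t ω i - B 0 ω i) with hY
  have hTY : ∀ᵐ ω ∂P, ∀ i, T (stepMap x) ω i = Y i ω := by
    have h' : ∀ᵐ ω ∂P, ∀ t ∈ x.support, (x t • T (timeIndicator t) : Lp _ 2 P) ω =
        x t • (B t ω - B 0 ω) := by
      rw [Filter.eventually_all_finset]
      intro t _
      filter_upwards [Lp.coeFn_smul (x t) (T (timeIndicator t)), hT t] with ω h1 h2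
      rw [h1, Pi.smul_apply, ← h2]
    filter_upwards [h', Lp.coeFn_finsetSum x.support fun t ↦ x t • T (timeIndicator t)]
      with ω h1 h2 i
    simp only [stepMap, Finsupp.linearCombination_apply, Finsupp.sum, map_sum, map_smul]
    rw [h2, Finset.sum_apply, Finset.sum_congr rfl h1]
    simp [hY]
  -- The coordinates of `B` being independent, so are their integrals, and the characteristic
  -- function of `⟪v, T (stepMap x)⟫` is a product.
  have hind : ProbabilityTheory.iIndepFun (fun i ω ↦ v i * Y i ω) P := by
    refine hB.iIndepFun.comp
      (fun i (w : ℝ≥0 → ℝ) ↦ v i * ∑ t ∈ x.support, x t * (w t - w 0)) fun i ↦ ?_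
    fun_prop
  have hlaw (i : Fin n) : HasLaw (fun ω ↦ v i * Y i ω) _ P :=
    gaussianReal_const_mul (hB.hasLaw_sum_mul_sub i x) (v i)
  have h1 : charFun (P.map (T (stepMap x))) v = charFun (P.map fun ω ↦ ∑ i, v i * Y i ω) 1 := by
    rw [charFun_apply, charFun_apply, integral_map (Lp.aestronglyMeasurable _).aemeasurable
      (by fun_prop), integral_map (Finset.aemeasurable_fun_sum _ fun i _ ↦ (hlaw i).aemeasurable)
      (by fun_prop)]
    refine integral_congr_ae ?_
    filter_upwards [hTY] with ω hω
    simp [PiLp.inner_apply, hω]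
  rw [h1, hind.charFun_map_fun_sum_eq_prod fun i ↦ (hlaw i).aemeasurable, Finset.prod_apply]
  simp only [(hlaw _).map_eq, charFun_gaussianReal]
  rw [← Complex.exp_sum, EuclideanSpace.real_norm_sq_eq]
  congr 1
  simp only [Finset.sum_mul, Finset.sum_div, Complex.ofReal_sum, ← Finset.sum_neg_distrib]
  refine Finset.sum_congr rfl fun i _ ↦ ?_
  push_cast
  simp

end IsBrownianMotionFrom

/-- Convergence in `L²` implies convergence in law, hence of the characteristic functions. -/
lemma continuous_charFun_map_Lp [IsProbabilityMeasure P] {E : Type*} [NormedAddCommGroup E]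
    [InnerProductSpace ℝ E] [MeasurableSpace E] [BorelSpace E] [SecondCountableTopology E] (v : E) :
    Continuous fun f : Lp E 2 P ↦ charFun (P.map f) v := by
  rw [continuous_iff_continuousAt]
  intro f
  have h : TendstoInDistribution (fun g : Lp E 2 P ↦ (g : Ω → E)) (𝓝 f) f (fun _ ↦ P) P :=
    (tendstoInMeasure_of_tendsto_Lp tendsto_id).tendstoInDistribution
      fun g ↦ (Lp.aestronglyMeasurable g).aemeasurable
  have h' := (ProbabilityMeasure.tendsto_iff_forall_integral_rclike_tendsto ℂ).1 h.tendsto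
    (BoundedContinuousFunction.innerProbChar v)
  simp only [ContinuousAt, charFun_eq_integral_innerProbChar]
  exact h'

namespace IsBrownianMotionFrom

variable {n : ℕ} {a : EuclideanSpace ℝ (Fin n)} {B : ℝ≥0 → Ω → EuclideanSpace ℝ (Fin n)}
  [IsProbabilityMeasure P] {T : Lp ℝ 2 timeMeasure →L[ℝ] Lp (EuclideanSpace ℝ (Fin n)) 2 P}

/-- The Wiener integral of `f` against an `n`-dimensional Brownian motion is a centered Gaussian
vector with covariance matrix `‖f‖² I`. -/
lemma charFun_map_integrator (hB : IsBrownianMotionFrom a B P) (hT : IsIntegrator P B T)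
    (f : Lp ℝ 2 timeMeasure) (v : EuclideanSpace ℝ (Fin n)) :
    charFun (P.map (T f)) v = Complex.exp (-((‖v‖ ^ 2 * ‖f‖ ^ 2 / 2 : ℝ) : ℂ)) := by
  have h1 : Continuous fun f ↦ charFun (P.map (T f)) v :=
    (continuous_charFun_map_Lp v).comp T.continuous
  have h2 : Continuous fun f : Lp ℝ 2 timeMeasure ↦
      Complex.exp (-((‖v‖ ^ 2 * ‖f‖ ^ 2 / 2 : ℝ) : ℂ)) := by fun_prop
  exact congrFun (denseRange_stepMap.equalizer h1 h2
    (funext fun x ↦ hB.charFun_map_integrator_step hT x v)) f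

lemma map_integrator_eq_of_norm_eq (hB : IsBrownianMotionFrom a B P) (hT : IsIntegrator P B T)
    {f g : Lp ℝ 2 timeMeasure} (h : ‖f‖ = ‖g‖) : P.map (T f) = P.map (T g) := by
  have hm (f : Lp ℝ 2 timeMeasure) : AEMeasurable (T f) P :=
    (Lp.aestronglyMeasurable _).aemeasurable
  have := Measure.isProbabilityMeasure_map (hm f)
  have := Measure.isProbabilityMeasure_map (hm g)
  refine Measure.ext_of_charFun (funext fun v ↦ ?_)
  rw [hB.charFun_map_integrator hT, hB.charFun_map_integrator hT, h]

/-- The law of a Wiener integral depends continuously on the norm of the integrand: the integrand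
`f i` may be replaced by the multiple of `g` of the same norm, and these multiples converge
to `g`. -/
lemma tendstoInDistribution_integrator (hB : IsBrownianMotionFrom a B P) (hT : IsIntegrator P B T)
    {ι : Type*} {l : Filter ι} [l.NeBot] [l.IsCountablyGenerated] {f : ι → Lp ℝ 2 timeMeasure}
    {g : Lp ℝ 2 timeMeasure} (h : Tendsto (fun i ↦ ‖f i‖) l (𝓝 ‖g‖)) :
    TendstoInDistribution (fun i ↦ (T (f i) : Ω → EuclideanSpace ℝ (Fin n))) l (T g)
      (fun _ ↦ P) P := by
  have hm (f : Lp ℝ 2 timeMeasure) : AEMeasurable (T f) P :=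
    (Lp.aestronglyMeasurable _).aemeasurable
  have key {f' : ι → Lp ℝ 2 timeMeasure} (hf' : Tendsto f' l (𝓝 g)) :
      TendstoInDistribution (fun i ↦ (T (f' i) : Ω → EuclideanSpace ℝ (Fin n))) l (T g)
        (fun _ ↦ P) P :=
    (tendstoInMeasure_of_tendsto_Lp ((T.continuous.tendsto g).comp hf')).tendstoInDistribution
      fun i ↦ hm _
  rcases eq_or_ne g 0 with rfl | hg
  · exact key (tendsto_zero_iff_norm_tendsto_zero.2 (by simpa using h))
  have hg0 : ‖g‖ ≠ 0 := norm_ne_zero_iff.2 hg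
  have hlim : Tendsto (fun i ↦ (‖f i‖ / ‖g‖) • g) l (𝓝 g) := by
    simpa [hg0] using (h.div_const ‖g‖).smul_const g
  have hnorm (i : ι) : ‖(‖f i‖ / ‖g‖) • g‖ = ‖f i‖ := by
    rw [norm_smul, norm_div, norm_norm, norm_norm, div_mul_cancel₀ _ hg0]
  refine ⟨fun i ↦ hm _, hm _, ?_⟩
  have h1 := (key hlim).tendsto
  simp only [hB.map_integrator_eq_of_norm_eq hT (hnorm _)] at h1
  exact h1

end IsBrownianMotionFrom

/-! ### The deterministic integrands -/

/-- Multiplication by a bounded function, as a bounded operator on `L²(0, ∞)`. -/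
def mulOp (ρ : Lp ℝ ∞ timeMeasure) : Lp ℝ 2 timeMeasure →L[ℝ] Lp ℝ 2 timeMeasure :=
  (ContinuousLinearMap.mul ℝ ℝ).holderL timeMeasure ∞ 2 2 ρ

lemma coeFn_mulOp {ρ : ℝ → ℝ} (hρ : MemLp ρ ∞ timeMeasure) (f : Lp ℝ 2 timeMeasure) :
    mulOp (hρ.toLp ρ) f =ᵐ[timeMeasure] fun s ↦ ρ s * f s := by
  filter_upwards [(ContinuousLinearMap.mul ℝ ℝ).coeFn_holder (r := 2) (hρ.toLp ρ) f,
    hρ.coeFn_toLp] with s h1 h2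
  rw [mulOp, ContinuousLinearMap.holderL_apply_apply, h1, h2]
  rfl

lemma memLp_upTo {f : ℝ → ℝ} (hf : Continuous f) (t : ℝ≥0) : MemLp (upTo t f) 2 timeMeasure := by
  refine MemLp.restrict _ ((memLp_indicator_iff_restrict measurableSet_Ioc).2 ?_)
  refine (memLp_two_iff_integrable_sq hf.aestronglyMeasurable).2 ?_
  exact (hf.pow 2).integrableOn_Ioc

lemma mulOp_timeIndicator {ρ : ℝ → ℝ} (hρ : MemLp ρ ∞ timeMeasure) (t : ℝ≥0)
    (h : MemLp (upTo t ρ) 2 timeMeasure) :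
    mulOp (hρ.toLp ρ) (timeIndicator t) = h.toLp _ := by
  refine Lp.ext ?_
  filter_upwards [coeFn_mulOp hρ (timeIndicator t), h.coeFn_toLp, coeFn_timeIndicator t]
    with s h1 h2 h3
  rw [h1, h2, h3, upTo]
  simp [Set.indicator_apply]

lemma norm_sq_toLp {f : ℝ → ℝ} (hf : MemLp f 2 timeMeasure) :
    ‖hf.toLp f‖ ^ 2 = ∫ s in Set.Ioi 0, f s ^ 2 := by
  rw [← real_inner_self_eq_norm_sq, L2.inner_def]
  refine integral_congr_ae ?_
  filter_upwards [hf.coeFn_toLp] with s hs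
  rw [hs]
  simp

section Coefficients

variable {n : ℕ}

lemma continuous_radialCoeff : Continuous (radialCoeff n) := by unfold radialCoeff; fun_prop

lemma continuous_tangentialCoeff : Continuous (tangentialCoeff n) := by
  unfold tangentialCoeff; fun_prop

lemma continuous_growth : Continuous (growth n) := by unfold growth; fun_prop

lemma continuous_decay : Continuous (decay n) := by unfold decay; fun_prop

lemma exp_neg_mul_le_one {s : ℝ} (hs : 0 ≤ s) : Real.exp (-(n * s)) ≤ 1 :=
  Real.exp_le_one_iff.2 (neg_nonpos.2 (by positivity))

lemma abs_radialCoeff_sub_one_le {s : ℝ} (hs : 0 ≤ s) :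
    |radialCoeff n s - 1| ≤ Real.exp (-(n * s)) := by
  have h1 := exp_neg_mul_le_one (n := n) hs
  have h0 := Real.exp_pos (-(n * s))
  have h2 : radialCoeff n s ≤ 1 := Real.sqrt_le_one.2 (by linarith)
  have h3 : 1 - Real.exp (-(n * s)) ≤ radialCoeff n s :=
    Real.le_sqrt_of_sq_le (by nlinarith)
  rw [abs_le]
  constructor <;> linarith

lemma abs_tangentialCoeff_sub_one_le (hn : 2 ≤ n) (s : ℝ) :
    |tangentialCoeff n s - 1| ≤ Real.exp (-(n * s)) := by
  have hn' : (2 : ℝ) ≤ n := by exact_mod_cast hn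
  have h0 := Real.exp_pos (-(n * s))
  have h1 : 0 ≤ Real.exp (-(n * s)) / (n - 1) := div_nonneg h0.le (by linarith)
  have h2 : Real.exp (-(n * s)) / (n - 1) ≤ Real.exp (-(n * s)) :=
    div_le_self h0.le (by linarith)
  have h3 : 1 ≤ tangentialCoeff n s := Real.one_le_sqrt.2 (by linarith)
  have h4 : tangentialCoeff n s ≤ 1 + Real.exp (-(n * s)) :=
    Real.sqrt_le_iff.2 ⟨by positivity, by nlinarith⟩
  rw [abs_le]
  constructor <;> linarith

/-- A continuous function at distance at most `1` from `1` is a bounded multiplier. -/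
lemma memLp_top_of_abs_sub_one_le {ρ : ℝ → ℝ} (hc : Continuous ρ)
    (h : ∀ s, 0 ≤ s → |ρ s - 1| ≤ Real.exp (-(n * s))) : MemLp ρ ∞ timeMeasure := by
  refine memLp_top_of_bound hc.aestronglyMeasurable 2 ?_
  filter_upwards [ae_restrict_mem measurableSet_Ioi] with s (hs : 0 < s)
  have h1 := abs_le.1 ((h s hs.le).trans (exp_neg_mul_le_one hs.le))
  rw [Real.norm_eq_abs, abs_le]
  constructor <;> linarith

lemma decay_sq (s : ℝ) : decay n s ^ 2 = Real.exp (-(n - 1) * s) := by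
  rw [decay, ← Real.exp_nat_mul]
  congr 1
  push_cast
  ring

lemma integrableOn_decay_sq (hn : 2 ≤ n) :
    IntegrableOn (fun s ↦ decay n s ^ 2) (Set.Ioi 0) := by
  have hn' : (2 : ℝ) ≤ n := by exact_mod_cast hn
  simp only [decay_sq]
  exact integrableOn_exp_mul_Ioi (by linarith) 0

lemma memLp_decay (hn : 2 ≤ n) : MemLp (decay n) 2 timeMeasure :=
  (memLp_two_iff_integrable_sq continuous_decay.aestronglyMeasurable).2 (integrableOn_decay_sq hn)

lemma tendsto_decay (hn : 2 ≤ n) : Tendsto (fun t : ℝ≥0 ↦ decay n t) atTop (𝓝 0) := by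
  have hn' : (2 : ℝ) ≤ n := by exact_mod_cast hn
  have h : Tendsto (fun t : ℝ≥0 ↦ ((n : ℝ) - 1) / 2 * t) atTop atTop :=
    (NNReal.tendsto_coe_atTop.2 tendsto_id).const_mul_atTop (by linarith)
  exact Real.tendsto_exp_neg_atTop_nhds_zero.comp h

lemma exp_neg_mul_mul_growth_le {s : ℝ} (hs : 0 ≤ s) :
    Real.exp (-(n * s)) * growth n s ≤ decay n s := by
  rw [growth, decay, ← Real.exp_add, Real.exp_le_exp]
  linarith

/-- The class in `L²(0, ∞)` of the integrand `e^{(n-1)s/2} 1_{(0, t]}`. -/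
def growthLp (n : ℕ) (t : ℝ≥0) : Lp ℝ 2 timeMeasure :=
  (memLp_upTo (continuous_growth (n := n)) t).toLp _

/-- A multiplier that tends to `1` like `e^{-ns}` changes the integrand `e^{(n-1)s/2} 1_{(0, t]}` by
an amount that is bounded in `L²(0, ∞)` uniformly in `t`. -/
lemma norm_mulOp_growthLp_sub_le (hn : 2 ≤ n) {ρ : ℝ → ℝ} (hρ : MemLp ρ ∞ timeMeasure)
    (h : ∀ s, 0 ≤ s → |ρ s - 1| ≤ Real.exp (-(n * s))) (t : ℝ≥0) :
    ‖mulOp (hρ.toLp ρ) (growthLp n t) - growthLp n t‖ ≤ ‖(memLp_decay hn).toLp _‖ := by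
  refine Lp.norm_le_norm_of_ae_le ?_
  filter_upwards [Lp.coeFn_sub (mulOp (hρ.toLp ρ) (growthLp n t)) (growthLp n t),
    coeFn_mulOp hρ (growthLp n t), (memLp_upTo (continuous_growth (n := n)) t).coeFn_toLp,
    (memLp_decay hn).coeFn_toLp, ae_restrict_mem measurableSet_Ioi] with s h1 h2 h3 h4 (h5 : 0 < s)
  have hg : |upTo t (growth n) s| ≤ growth n s := by
    have h0 : 0 ≤ growth n s := (Real.exp_pos _).le
    rw [upTo, Set.indicator_apply]
    split_ifs
    · exact (abs_of_nonneg h0).le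
    · simpa using h0
  have hd : 0 ≤ decay n s := (Real.exp_pos _).le
  rw [h1, Pi.sub_apply, h2, h4, growthLp, h3, Real.norm_eq_abs, Real.norm_eq_abs, abs_of_nonneg hd,
    ← sub_one_mul, abs_mul]
  exact (mul_le_mul (h s h5.le) hg (abs_nonneg _) (Real.exp_pos _).le).trans
    (exp_neg_mul_mul_growth_le h5.le)

/-- Time reversal: `e^{-(n-1)t/2} e^{(n-1)s/2} 1_{(0, t]}(s)` has the norm in `L²(0, ∞)` of
`e^{-(n-1)u/2} 1_{(0, t]}(u)`, as is seen by substituting `u = t - s`. -/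
lemma norm_sq_decay_smul_growthLp (t : ℝ≥0) :
    ‖decay n t • growthLp n t‖ ^ 2 = ∫ u in (0 : ℝ)..t, decay n u ^ 2 := by
  have h (s : ℝ) : upTo t (growth n) s ^ 2 =
      (Set.Ioc 0 (t : ℝ)).indicator (fun s ↦ growth n s ^ 2) s := by
    rw [upTo, Set.indicator_apply, Set.indicator_apply]
    split_ifs <;> simp
  have h' (s : ℝ) : decay n t ^ 2 * growth n s ^ 2 = decay n (t - s) ^ 2 := by
    rw [← mul_pow, decay, decay, growth, ← Real.exp_add]
    ring_nf
  have hrev := intervalIntegral.integral_comp_sub_left (a := 0) (b := (t : ℝ))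
    (fun u ↦ decay n u ^ 2) t
  rw [sub_self, sub_zero] at hrev
  rw [norm_smul, mul_pow, growthLp, norm_sq_toLp, Real.norm_eq_abs, sq_abs]
  simp only [h]
  rw [setIntegral_indicator measurableSet_Ioc, Set.inter_eq_right.2 Set.Ioc_subset_Ioi_self,
    ← intervalIntegral.integral_of_le t.coe_nonneg, ← intervalIntegral.integral_const_mul]
  simp only [h']
  exact hrev

lemma tendsto_norm_decay_smul_growthLp (hn : 2 ≤ n) :
    Tendsto (fun t : ℝ≥0 ↦ ‖decay n t • growthLp n t‖) atTop
      (𝓝 ‖(memLp_decay hn).toLp _‖) := by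
  have h : Tendsto (fun t : ℝ≥0 ↦ ‖decay n t • growthLp n t‖ ^ 2) atTop
      (𝓝 (‖(memLp_decay hn).toLp _‖ ^ 2)) := by
    simp only [norm_sq_decay_smul_growthLp, norm_sq_toLp]
    exact intervalIntegral_tendsto_integral_Ioi 0 (integrableOn_decay_sq hn)
      (NNReal.tendsto_coe_atTop.2 tendsto_id)
  simpa using h.sqrt

end Coefficients

/-! ### The martingale `M` and the limit theorem -/

lemma IsIntegrator.compLpL {E F : Type*} [NormedAddCommGroup E] [NormedSpace ℝ E]
    [NormedAddCommGroup F] [NormedSpace ℝ F] {X : ℝ≥0 → Ω → E}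
    {T : Lp ℝ 2 timeMeasure →L[ℝ] Lp E 2 P} (hT : IsIntegrator P X T) (L : E →L[ℝ] F) :
    IsIntegrator P (fun t ω ↦ L (X t ω)) (L.compLpL 2 P ∘L T) := by
  intro t
  filter_upwards [hT t, L.coeFn_compLpL (p := 2) (T (timeIndicator t))] with ω h1 h2
  rw [ContinuousLinearMap.comp_apply, h2, ← h1, map_sub]

/-- The rank one operator `x ↦ ⟪θ, x⟫ θ`, which for a unit vector `θ` is the orthogonal projection
onto the line spanned by `θ`. -/
def radialProj {n : ℕ} (θ : EuclideanSpace ℝ (Fin n)) :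
    EuclideanSpace ℝ (Fin n) →L[ℝ] EuclideanSpace ℝ (Fin n) :=
  (innerSL ℝ θ).smulRight θ

/-- The complementary operator `x ↦ x - ⟪θ, x⟫ θ`. -/
def tangentialProj {n : ℕ} (θ : EuclideanSpace ℝ (Fin n)) :
    EuclideanSpace ℝ (Fin n) →L[ℝ] EuclideanSpace ℝ (Fin n) :=
  ContinuousLinearMap.id ℝ _ - radialProj θ

section

variable {n : ℕ} {θ : EuclideanSpace ℝ (Fin n)} {B : ℝ≥0 → Ω → EuclideanSpace ℝ (Fin n)}
  {T : Lp ℝ 2 timeMeasure →L[ℝ] Lp (EuclideanSpace ℝ (Fin n)) 2 P}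

lemma IsIntegrator.radialPart (hT : IsIntegrator P B T) :
    IsIntegrator P (radialPart θ B) ((innerSL ℝ θ).compLpL 2 P ∘L T) :=
  hT.compLpL (innerSL ℝ θ)

lemma IsIntegrator.tangentialPart (hT : IsIntegrator P B T) :
    IsIntegrator P (tangentialPart θ B) ((tangentialProj θ).compLpL 2 P ∘L T) :=
  hT.compLpL (tangentialProj θ)

lemma memLp_radialCoeff : MemLp (radialCoeff n) ∞ timeMeasure :=
  memLp_top_of_abs_sub_one_le continuous_radialCoeff fun _ ↦ abs_radialCoeff_sub_one_le

lemma memLp_tangentialCoeff (hn : 2 ≤ n) : MemLp (tangentialCoeff n) ∞ timeMeasure :=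
  memLp_top_of_abs_sub_one_le continuous_tangentialCoeff fun s _ ↦
    abs_tangentialCoeff_sub_one_le hn s

/-- The operator that integrates against the martingale `M`, when `T` integrates against `B`: the
integrand is multiplied by the radial and the tangential coefficient, and the integrals of the two
products against `B` are projected onto the line of `θ` and onto its orthogonal hyperplane. -/
def martingaleIntegrator (hn : 2 ≤ n) (θ : EuclideanSpace ℝ (Fin n))
    (T : Lp ℝ 2 timeMeasure →L[ℝ] Lp (EuclideanSpace ℝ (Fin n)) 2 P) :
    Lp ℝ 2 timeMeasure →L[ℝ] Lp (EuclideanSpace ℝ (Fin n)) 2 P :=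
  √(1 - 1 / (n : ℝ)) • ((radialProj θ).compLpL 2 P ∘L T ∘L
      mulOp (memLp_radialCoeff.toLp (radialCoeff n)) +
    (tangentialProj θ).compLpL 2 P ∘L T ∘L mulOp ((memLp_tangentialCoeff hn).toLp _))

lemma limitMartingale_ae_eq (hn : 2 ≤ n) (hT : IsIntegrator P B T) (t : ℝ≥0) :
    limitMartingale P θ B t =ᵐ[P] martingaleIntegrator hn θ T (timeIndicator t) := by
  have hr := memLp_upTo (continuous_radialCoeff (n := n)) t
  have ht := memLp_upTo (continuous_tangentialCoeff (n := n)) t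
  set U : Lp _ 2 P := (radialProj θ).compLpL 2 P (T (hr.toLp _)) with hU
  set V : Lp _ 2 P := (tangentialProj θ).compLpL 2 P (T (ht.toLp _)) with hV
  have h : martingaleIntegrator hn θ T (timeIndicator t) = √(1 - 1 / (n : ℝ)) • (U + V) := by
    simp only [martingaleIntegrator, hU, hV, ← mulOp_timeIndicator memLp_radialCoeff t hr,
      ← mulOp_timeIndicator (memLp_tangentialCoeff hn) t ht]
    rfl
  filter_upwards [(hT.radialPart (θ := θ)).wienerIntegral_ae_eq hr,
    (hT.tangentialPart (θ := θ)).wienerIntegral_ae_eq ht,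
    (innerSL ℝ θ).coeFn_compLpL (p := 2) (T (hr.toLp _)),
    (radialProj θ).coeFn_compLpL (p := 2) (T (hr.toLp _)),
    Lp.coeFn_smul (√(1 - 1 / (n : ℝ))) (U + V), Lp.coeFn_add U V] with ω h1 h2 h3 h4 h5 h6
  rw [h, h5, Pi.smul_apply, h6, Pi.add_apply, limitMartingale, h1, h2,
    ContinuousLinearMap.comp_apply, h3, hU, h4]
  rfl

lemma isIntegrator_limitMartingale (hn : 2 ≤ n) (hT : IsIntegrator P B T) :
    IsIntegrator P (limitMartingale P θ B) (martingaleIntegrator hn θ T) := by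
  intro t
  have h0 := limitMartingale_ae_eq (θ := θ) hn hT 0
  rw [timeIndicator_zero, map_zero] at h0
  filter_upwards [limitMartingale_ae_eq (θ := θ) hn hT t, h0,
    Lp.coeFn_zero (EuclideanSpace ℝ (Fin n)) 2 P] with ω h1 h2 h3
  rw [h1, h2, h3, Pi.zero_apply, sub_zero]

lemma limitProcess_ae_eq (hn : 2 ≤ n) (hT : IsIntegrator P B T) (t : ℝ≥0) :
    limitProcess P θ B t =ᵐ[P]
      (decay n t • martingaleIntegrator hn θ T (growthLp n t) : Lp _ 2 P) := by
  filter_upwards [(isIntegrator_limitMartingale (θ := θ) hn hT).wienerIntegral_ae_eq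
    (memLp_upTo (continuous_growth (n := n)) t),
    Lp.coeFn_smul (decay n t) (martingaleIntegrator hn θ T (growthLp n t))] with ω h1 h2
  rw [limitProcess, h1, h2]
  rfl

lemma comparisonProcess_ae_eq (hT : IsIntegrator P B T) (t : ℝ≥0) :
    comparisonProcess P B t =ᵐ[P] T (√(1 - 1 / (n : ℝ)) • decay n t • growthLp n t) := by
  have hc : Continuous fun s ↦ √(1 - 1 / (n : ℝ)) * growth n s :=
    continuous_const.mul continuous_growth
  have h : (memLp_upTo hc t).toLp _ = √(1 - 1 / (n : ℝ)) • growthLp n t := by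
    rw [growthLp, ← MemLp.toLp_const_smul]
    refine MemLp.toLp_congr _ _ (ae_of_all _ fun s ↦ ?_)
    simp [upTo, Set.indicator_apply]
  rw [smul_comm, ← h, map_smul]
  filter_upwards [hT.wienerIntegral_ae_eq (memLp_upTo hc t),
    Lp.coeFn_smul (decay n t) (T ((memLp_upTo hc t).toLp _))] with ω h1 h2
  rw [comparisonProcess, h1, h2]
  rfl

lemma limitVector_ae_eq (hn : 2 ≤ n) (hT : IsIntegrator P B T) :
    limitVector P B =ᵐ[P] T (√(1 - 1 / (n : ℝ)) • (memLp_decay hn).toLp _) := by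
  rw [map_smul]
  filter_upwards [hT.wienerIntegral_ae_eq (memLp_decay hn),
    Lp.coeFn_smul (√(1 - 1 / (n : ℝ))) (T ((memLp_decay hn).toLp _))] with ω h1 h2
  rw [limitVector, h1, h2]
  rfl

/-- Since the two projections add up to the identity, integrating against `M` instead of
`√(1 - 1/n) B` only involves the differences of the two coefficients to `1`. -/
lemma norm_martingaleIntegrator_growthLp_sub_le (hn : 2 ≤ n) (t : ℝ≥0) :
    ‖martingaleIntegrator hn θ T (growthLp n t) - T (√(1 - 1 / (n : ℝ)) • growthLp n t)‖ ≤
      √(1 - 1 / (n : ℝ)) * ((‖(radialProj θ).compLpL 2 P ∘L T‖ +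
        ‖(tangentialProj θ).compLpL 2 P ∘L T‖) * ‖(memLp_decay hn).toLp _‖) := by
  set G := growthLp n t
  have hsplit (f : Lp (EuclideanSpace ℝ (Fin n)) 2 P) :
      f = (radialProj θ).compLpL 2 P f + (tangentialProj θ).compLpL 2 P f := by
    refine Lp.ext ?_
    filter_upwards [Lp.coeFn_add ((radialProj θ).compLpL 2 P f) ((tangentialProj θ).compLpL 2 P f),
      (radialProj θ).coeFn_compLpL (p := 2) f, (tangentialProj θ).coeFn_compLpL (p := 2) f]
      with ω h1 h2 h3
    rw [h1, Pi.add_apply, h2, h3, tangentialProj]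
    simp
  have hdiff : martingaleIntegrator hn θ T G - T (√(1 - 1 / (n : ℝ)) • G) =
      √(1 - 1 / (n : ℝ)) • (((radialProj θ).compLpL 2 P ∘L T)
        (mulOp (memLp_radialCoeff.toLp (radialCoeff n)) G - G) +
          ((tangentialProj θ).compLpL 2 P ∘L T)
            (mulOp ((memLp_tangentialCoeff hn).toLp _) G - G)) := by
    rw [map_smul, martingaleIntegrator, smul_apply, ← smul_sub]
    congr 1
    refine (congrArg (_ - ·) (hsplit (T G))).trans ?_
    simp only [add_apply, ContinuousLinearMap.comp_apply, map_sub]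
    abel
  rw [hdiff, norm_smul, Real.norm_of_nonneg (Real.sqrt_nonneg _)]
  refine mul_le_mul_of_nonneg_left ((norm_add_le _ _).trans ?_) (Real.sqrt_nonneg _)
  rw [add_mul]
  exact add_le_add
    (ContinuousLinearMap.le_opNorm_of_le _ (norm_mulOp_growthLp_sub_le hn memLp_radialCoeff
      (fun _ ↦ abs_radialCoeff_sub_one_le) t))
    (ContinuousLinearMap.le_opNorm_of_le _ (norm_mulOp_growthLp_sub_le hn
      (memLp_tangentialCoeff hn) (fun s _ ↦ abs_tangentialCoeff_sub_one_le hn s) t))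

lemma tendsto_eLpNorm_limitProcess_sub (hn : 2 ≤ n) (hT : IsIntegrator P B T) :
    Tendsto (fun t : ℝ≥0 ↦
      eLpNorm (fun ω ↦ limitProcess P θ B t ω - comparisonProcess P B t ω) 2 P) atTop (𝓝 0) := by
  set D : ℝ≥0 → Lp (EuclideanSpace ℝ (Fin n)) 2 P := fun t ↦ decay n t •
    (martingaleIntegrator hn θ T (growthLp n t) - T (√(1 - 1 / (n : ℝ)) • growthLp n t)) with hD
  have hnorm (t : ℝ≥0) :
      eLpNorm (fun ω ↦ limitProcess P θ B t ω - comparisonProcess P B t ω) 2 P = ‖D t‖ₑ := by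
    have hDt : D t = decay n t • martingaleIntegrator hn θ T (growthLp n t) -
        T (√(1 - 1 / (n : ℝ)) • decay n t • growthLp n t) := by
      rw [hD, smul_comm (√(1 - 1 / (n : ℝ))) (decay n t), map_smul T (decay n t), ← smul_sub]
    rw [hDt, Lp.enorm_def]
    refine eLpNorm_congr_ae ?_
    filter_upwards [limitProcess_ae_eq (θ := θ) hn hT t, comparisonProcess_ae_eq hT t,
      Lp.coeFn_sub (decay n t • martingaleIntegrator hn θ T (growthLp n t))
        (T (√(1 - 1 / (n : ℝ)) • decay n t • growthLp n t))] with ω h1 h2 h3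
    rw [h1, h2, h3, Pi.sub_apply]
  have hlim : Tendsto D atTop (𝓝 0) := by
    refine squeeze_zero_norm (a := fun t : ℝ≥0 ↦ decay n t * (√(1 - 1 / (n : ℝ)) *
      ((‖(radialProj θ).compLpL 2 P ∘L T‖ + ‖(tangentialProj θ).compLpL 2 P ∘L T‖) *
        ‖(memLp_decay hn).toLp _‖))) (fun t : ℝ≥0 ↦ ?_) ?_
    · have h0 : 0 ≤ decay n t := (Real.exp_pos _).le
      rw [hD, norm_smul, Real.norm_of_nonneg h0]
      exact mul_le_mul_of_nonneg_left (norm_martingaleIntegrator_growthLp_sub_le hn t) h0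
    · rw [← zero_mul (√(1 - 1 / (n : ℝ)) * ((‖(radialProj θ).compLpL 2 P ∘L T‖ +
        ‖(tangentialProj θ).compLpL 2 P ∘L T‖) * ‖(memLp_decay hn).toLp _‖))]
      exact (tendsto_decay hn).mul_const _
  simp only [hnorm]
  simpa using hlim.enorm

lemma tendstoInDistribution_limitProcess [IsProbabilityMeasure P] {a : EuclideanSpace ℝ (Fin n)}
    (hn : 2 ≤ n) (hB : IsBrownianMotionFrom a B P) (hT : IsIntegrator P B T) :
    TendstoInDistribution (fun t : ℝ≥0 ↦ limitProcess P θ B t) atTop (limitVector P B)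
      (fun _ ↦ P) P := by
  have hZ (t : ℝ≥0) : AEStronglyMeasurable (limitProcess P θ B t) P :=
    (Lp.aestronglyMeasurable _).congr (limitProcess_ae_eq hn hT t).symm
  have hC (t : ℝ≥0) : AEStronglyMeasurable (comparisonProcess P B t) P :=
    (Lp.aestronglyMeasurable _).congr (comparisonProcess_ae_eq hT t).symm
  have hnorm : Tendsto (fun t : ℝ≥0 ↦ ‖√(1 - 1 / (n : ℝ)) • decay n t • growthLp n t‖) atTop
      (𝓝 ‖√(1 - 1 / (n : ℝ)) • (memLp_decay hn).toLp _‖) := by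
    simp only [norm_smul (√(1 - 1 / (n : ℝ)))]
    exact (tendsto_norm_decay_smul_growthLp hn).const_mul _
  have hlaw : TendstoInDistribution (fun t : ℝ≥0 ↦ comparisonProcess P B t) atTop
      (limitVector P B) (fun _ ↦ P) P :=
    (hB.tendstoInDistribution_integrator hT hnorm).congr
      (fun t ↦ (comparisonProcess_ae_eq hT t).symm) (limitVector_ae_eq hn hT).symm
  refine tendstoInDistribution_of_tendstoInMeasure_sub _ _ hlaw ?_ fun t ↦ (hZ t).aemeasurable
  refine tendstoInMeasure_of_tendsto_eLpNorm two_ne_zero (fun t ↦ (hZ t).sub (hC t))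
    aestronglyMeasurable_zero ?_
  simpa using! tendsto_eLpNorm_limitProcess_sub (θ := θ) hn hT

end

end

theorem proposition2 {Ω : Type*} [MeasurableSpace Ω] (P : Measure Ω) [IsProbabilityMeasure P]
    (n : ℕ) (hn : 2 ≤ n) (θ : EuclideanSpace ℝ (Fin n)) (hθ : ‖θ‖ = 1)
    (a : EuclideanSpace ℝ (Fin n)) (B : ℝ≥0 → Ω → EuclideanSpace ℝ (Fin n))
    (hB : IsBrownianMotionFrom a B P) :
    -- all the stochastic integrals below exist
    ((∀ t : ℝ≥0,
        HasWienerIntegral P (radialPart θ B) (upTo t (radialCoeff n)) ∧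
        HasWienerIntegral P (tangentialPart θ B) (upTo t (tangentialCoeff n)) ∧
        HasWienerIntegral P (limitMartingale P θ B) (upTo t (growth n)) ∧
        HasWienerIntegral P B (upTo t (fun s ↦ √(1 - 1 / (n : ℝ)) * growth n s))) ∧
      HasWienerIntegral P B (decay n)) ∧
    -- (a) convergence in law
    TendstoInDistribution (fun t : ℝ≥0 ↦ limitProcess P θ B t) atTop (limitVector P B)
      (fun _ ↦ P) P ∧
    -- (b) convergence to zero in quadratic mean
    Tendsto (fun t : ℝ≥0 ↦
      eLpNorm (fun ω ↦ limitProcess P θ B t ω - comparisonProcess P B t ω) 2 P) atTop (𝓝 0) := by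
  obtain ⟨T, hT⟩ := hB.exists_isIntegrator
  refine ⟨⟨fun t ↦ ⟨?_, ?_, ?_, ?_⟩, ?_⟩, tendstoInDistribution_limitProcess hn hB hT,
    tendsto_eLpNorm_limitProcess_sub hn hT⟩
  · exact hT.radialPart.hasWienerIntegral (memLp_upTo continuous_radialCoeff t)
  · exact hT.tangentialPart.hasWienerIntegral (memLp_upTo continuous_tangentialCoeff t)
  · exact (isIntegrator_limitMartingale hn hT).hasWienerIntegral (memLp_upTo continuous_growth t)
  · exact hT.hasWienerIntegral (memLp_upTo (continuous_const.mul continuous_growth) t)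
  · exact hT.hasWienerIntegral (memLp_decay hn)

end
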